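/- **Setting.** Let $N\ge 1$, let $\Omega\subset\mathbb{R}^N$ be a bounded domain (bounded, connected, nonempty, open), and let $f\ge 0$ be a bounded Hölder continuous function on $\Omega$ which is not identically zero. Let $F$ be either a *regular* nonlinearity, with $a_F=\infty$, or a *singular* nonlinearity, with $a_F=1$. In both cases $F$ is smooth, nondecreasing and convex on $[0,a_F)$ with $F(0)=1$; in the regular case $F(t)/t\to\infty$ as $t\to\infty$, and in the singular case $F(t)\to\infty$ as $t\nearrow 1$. Put $$B_F=\sup_{0<\tau<a_F}\frac{\tau}{F(\tau)},\qquad C_F=\int_0^{a_F}\frac{d\tau}{F(\tau)}\in(0,\infty].$$ For $\lambda>0$, a *classical solution* of $$-\Delta u=\lambda f(x)F(u)\ \text{ in }\Omega,\qquad u=0\ \text{ on }\partial\Omega$$ is a function $u\in H^1_0(\Omega)$ with values in $[0,a_F)$ a.e. and $\|u\|_{L^\infty(\Omega)}<a_F$ such that $\int_\Omega\nabla u\cdot\nabla\varphi\,dx=\int_\Omega\lambda fF(u)\varphi\,dx$ for all $\varphi\in H^1_0(\Omega)$. Let $$\lambda^*(\Omega,f)=\sup\{\lambda>0:\text{ a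 classical solution exists}\}$$ (with $\sup\emptyset=0$). Let $\lambda_1(\Omega)$ be the smallest eigenvalue of $-\Delta$ in $H^1_0(\Omega)$, and let $\phi_\Omega$ be the corresponding a.e. positive eigenfunction, normalized by $\int_\Omega\phi_\Omega\,dx=1$. **Proposition.** With the convention $b/0=\infty$ for $b>0$, $$\lambda^*(\Omega,f)\le\lambda_1(\Omega)\,\min\left\{\frac{B_F}{\inf_\Omega f},\ \frac{C_F}{\int_\Omega f\,\phi_\Omega\,dx}\right\}.$$ -/

import Mathlib

open MeasureTheory Filter Topology Set
open scoped ENNReal NNReal ContDiff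

namespace PullIn

/-- The domain `D = [0, a)` of a nonlinearity, where `a = ∞` or `a = 1`. -/
def dom (a : ℝ≥0∞) : Set ℝ := {t | 0 ≤ t ∧ ENNReal.ofReal t < a}

/-- The open interval `(0, a)`. -/
def openDom (a : ℝ≥0∞) : Set ℝ := {t | 0 < t ∧ ENNReal.ofReal t < a}

/-- The requirements common to regular and singular nonlinearities: `F` is smooth, increasing
(in the weak sense) and convex on `[0, a)`, and `F 0 = 1`.
The values of `F` outside `[0, a)` play no role. -/
structure IsNonlinearity (a : ℝ≥0∞) (F : ℝ → ℝ) : Prop where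
  smooth : ContDiffOn ℝ ∞ F (dom a)
  mono : MonotoneOn F (dom a)
  convex : ConvexOn ℝ (dom a) F
  map_zero : F 0 = 1

/-- Regular nonlinearity: the domain is `[0, ∞)` and `F` is superlinear. -/
def IsRegularNonlinearity (F : ℝ → ℝ) : Prop :=
  IsNonlinearity ⊤ F ∧ Tendsto (fun t : ℝ => F t / t) atTop atTop

/-- Singular nonlinearity: the domain is `[0, 1)` and `F` blows up at `1`. -/
def IsSingularNonlinearity (F : ℝ → ℝ) : Prop :=
  IsNonlinearity 1 F ∧ Tendsto F (𝓝[<] 1) atTop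

/-- `B_F = sup_{0 < τ < a} τ / F τ`. -/
noncomputable def supConst (a : ℝ≥0∞) (F : ℝ → ℝ) : ℝ≥0∞ :=
  ⨆ τ ∈ openDom a, ENNReal.ofReal (τ / F τ)

/-- `C_F = ∫_0^a dτ / F τ`, which may be infinite. -/
noncomputable def intConst (a : ℝ≥0∞) (F : ℝ → ℝ) : ℝ≥0∞ :=
  ∫⁻ τ in openDom a, ENNReal.ofReal (1 / F τ)

variable {N : ℕ}

/-- A bounded domain: a bounded, connected (in particular nonempty) open set. -/
structure IsBoundedDomain (Ω : Set (EuclideanSpace ℝ (Fin N))) : Prop where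
  isOpen : IsOpen Ω
  isConnected : IsConnected Ω
  isBounded : Bornology.IsBounded Ω

/-- A permittivity profile: nonnegative, nonzero, bounded and Hölder continuous on `Ω`. -/
structure IsProfile (Ω : Set (EuclideanSpace ℝ (Fin N))) (f : EuclideanSpace ℝ (Fin N) → ℝ) :
    Prop where
  nonneg : ∀ x ∈ Ω, 0 ≤ f x
  nonzero : ∃ x ∈ Ω, f x ≠ 0
  bounded : ∃ M : ℝ, ∀ x ∈ Ω, f x ≤ M
  holder : ∃ C r : ℝ≥0, 0 < r ∧ r ≤ 1 ∧ HolderOnWith C r f Ω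

/-- Test functions: `C_c^∞(Ω)`. -/
structure IsTestFunction (Ω : Set (EuclideanSpace ℝ (Fin N))) (ψ : EuclideanSpace ℝ (Fin N) → ℝ) :
    Prop where
  smooth : ContDiff ℝ ∞ ψ
  hasCompactSupport : HasCompactSupport ψ
  tsupport_subset : tsupport ψ ⊆ Ω

/-- `v ∈ H¹₀(Ω)` with (weak) gradient `G`: the pair `(v, G)` is the limit in `L²(Ω)` of pairs
`(ψ n, ∇ (ψ n))` with `ψ n ∈ C_c^∞(Ω)`. In other words, `v` is in the closure of `C_c^∞(Ω)` for
the `H¹(Ω)` norm. Since weak derivatives pass to `L²` limits, `G` is the weak gradient of `v`,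
and `v` determines it almost everywhere in `Ω`. -/
structure MemH10With (Ω : Set (EuclideanSpace ℝ (Fin N))) (v : EuclideanSpace ℝ (Fin N) → ℝ)
    (G : EuclideanSpace ℝ (Fin N) → EuclideanSpace ℝ (Fin N)) : Prop where
  memLp : MemLp v 2 (volume.restrict Ω)
  memLp_grad : MemLp G 2 (volume.restrict Ω)
  approx : ∃ ψ : ℕ → EuclideanSpace ℝ (Fin N) → ℝ, (∀ n, IsTestFunction Ω (ψ n)) ∧
    Tendsto (fun n => eLpNorm (fun x => ψ n x - v x) 2 (volume.restrict Ω)) atTop (𝓝 0) ∧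
    Tendsto (fun n => eLpNorm (fun x => gradient (ψ n) x - G x) 2 (volume.restrict Ω))
      atTop (𝓝 0)

/-- `u ∈ H¹₀(Ω)` solves `-Δ u = g` in `Ω` weakly: `∫ ∇u · ∇φ = ∫ g φ` for all `φ ∈ H¹₀(Ω)`. -/
def IsWeakSolution (Ω : Set (EuclideanSpace ℝ (Fin N))) (u g : EuclideanSpace ℝ (Fin N) → ℝ) :
    Prop :=
  ∃ G, MemH10With Ω u G ∧ ∀ φ H, MemH10With Ω φ H →
    ∫ x in Ω, inner ℝ (G x) (H x) = ∫ x in Ω, g x * φ x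

/-- `u` is a classical solution of `-Δ u = lam f F(u)` in `Ω`, `u = 0` on `∂Ω`: it is a weak
solution in `H¹₀(Ω)`, with values in the domain `[0, a)` of `F`, for which `‖u‖_∞ < a`
(that is, `‖u‖_∞ < ∞` for regular and `‖u‖_∞ < 1` for singular `F`). -/
structure IsClassicalSolution (Ω : Set (EuclideanSpace ℝ (Fin N)))
    (f : EuclideanSpace ℝ (Fin N) → ℝ) (a : ℝ≥0∞) (F : ℝ → ℝ) (lam : ℝ)
    (u : EuclideanSpace ℝ (Fin N) → ℝ) : Prop where
  mem_dom : ∀ᵐ x ∂(volume.restrict Ω), u x ∈ dom a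
  norm_lt : eLpNorm u ⊤ (volume.restrict Ω) < a
  weak : IsWeakSolution Ω u (fun x => lam * f x * F (u x))

/-- The extremal parameter `λ*(Ω, f) = sup {λ > 0 : there is a classical solution}`. -/
noncomputable def extremalParameter (Ω : Set (EuclideanSpace ℝ (Fin N)))
    (f : EuclideanSpace ℝ (Fin N) → ℝ) (a : ℝ≥0∞) (F : ℝ → ℝ) : ℝ≥0∞ :=
  sSup (ENNReal.ofReal '' {lam : ℝ | 0 < lam ∧ ∃ u, IsClassicalSolution Ω f a F lam u})

/-- `φ` is an eigenfunction of `-Δ` in `H¹₀(Ω)` with eigenvalue `μ`. -/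
def IsEigenfunction (Ω : Set (EuclideanSpace ℝ (Fin N))) (μ : ℝ)
    (φ : EuclideanSpace ℝ (Fin N) → ℝ) : Prop :=
  ¬ (φ =ᵐ[volume.restrict Ω] 0) ∧ IsWeakSolution Ω φ (fun x => μ * φ x)

/-- `λ₁(Ω)`, the smallest eigenvalue of `-Δ` in `H¹₀(Ω)`. All the eigenvalues are nonnegative. -/
noncomputable def firstEigenvalue (Ω : Set (EuclideanSpace ℝ (Fin N))) : ℝ≥0∞ :=
  sInf (ENNReal.ofReal '' {μ : ℝ | ∃ φ, IsEigenfunction Ω μ φ})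

/-- `φ` is the positive eigenfunction for `λ₁(Ω)`, with the normalization `∫ φ = 1`. -/
structure IsFirstEigenfunction (Ω : Set (EuclideanSpace ℝ (Fin N)))
    (φ : EuclideanSpace ℝ (Fin N) → ℝ) : Prop where
  eigen : IsEigenfunction Ω (firstEigenvalue Ω).toReal φ
  pos : ∀ᵐ x ∂(volume.restrict Ω), 0 < φ x
  normalized : ∫ x in Ω, φ x = 1

end PullIn

/-! Each entry of the minimum comes from its own test-function argument, applied to an arbitrary
classical solution `u` for a parameter `λ`. Its values lie in a compact interval `[0, M]` inside
`[0, a)`.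

First bound: let `m = inf f` and suppose `B = B_F` is finite. Since `t ≤ B F(t)` and `F ≥ 1`, the
right-hand side satisfies `λ f F(u) ≥ κ (u + ε)` with `κ = λ m / (B + ε)`, so `u + ε` is a positive
supersolution. Testing with `ψ² / (u + ε)` and completing a square (Picone) gives `κ ∫ ψ² ≤ ∫ |∇ψ|²`
for every test function `ψ` (`mul_integral_le_of_supersolution`). By density every eigenvalue is at
least `κ` (`le_of_isEigenfunction`); then `ε → 0`. This argument never uses that an eigenfunction
exists or has a sign.

Second bound: put `K(t) = ∫_0^t dτ / F(τ) ≤ C_F`. As `F` is nondecreasing, `K` is concave, and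
formally `-Δ K(u) = λ f - K''(u) |∇u|² ≥ λ f`. Pairing with the positive eigenfunction `φ` gives `λ
∫ f φ ≤ λ₁ ∫ K(u) φ ≤ λ₁ C_F`. Since `F` is smooth only up to `0` from the right, `1 / F` is first
replaced by `1 / F(· + s)`, cut off outside a neighbourhood of `[0, M]`, and `s → 0` at the end
(`IsClassicalSolution.mul_integral_le`).

The Poincaré inequality gives `λ₁ > 0`, so that the right-hand side really is infinite when one of
the quotients is. -/

namespace PullIn

/-! ### Limits of products and pairings in `L²`. -/

section LTwo

variable {α E : Type*} [MeasurableSpace α] {μ : Measure α} [NormedAddCommGroup E]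

/-- Multiplication of a convergent sequence in `L²` by uniformly bounded functions converging
almost everywhere. -/
theorem tendsto_eLpNorm_smul_sub [NormedSpace ℝ E] {c : ℕ → α → ℝ} {c₀ : α → ℝ} {w : ℕ → α → E}
    {w₀ : α → E} {C : ℝ} (hcm : ∀ n, AEStronglyMeasurable (c n) μ)
    (hC : ∀ n, ∀ᵐ x ∂μ, |c n x| ≤ C)
    (hlim : ∀ᵐ x ∂μ, Tendsto (fun n => c n x) atTop (𝓝 (c₀ x)))
    (hwm : ∀ n, AEStronglyMeasurable (w n) μ) (hw₀ : MemLp w₀ 2 μ)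
    (hw : Tendsto (fun n => eLpNorm (fun x => w n x - w₀ x) 2 μ) atTop (𝓝 0)) :
    Tendsto (fun n => eLpNorm (fun x => c n x • w n x - c₀ x • w₀ x) 2 μ) atTop (𝓝 0) := by
  have hC₀ : ∀ᵐ x ∂μ, |c₀ x| ≤ C := by
    filter_upwards [ae_all_iff.2 hC, hlim] with x hx hl
    exact le_of_tendsto hl.abs (Eventually.of_forall hx)
  have hcm₀ : AEStronglyMeasurable c₀ μ := aestronglyMeasurable_of_tendsto_ae atTop hcm hlim
  -- Split `c n • w n - c₀ • w₀` as `c n • (w n - w₀) + (c n - c₀) • w₀`: the first term is small by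
  -- the uniform bound, the second by dominated convergence.
  have h1 : Tendsto (fun n => eLpNorm (fun x => c n x • (w n x - w₀ x)) 2 μ) atTop (𝓝 0) := by
    have : Tendsto (fun n => ENNReal.ofReal C * eLpNorm (fun x => w n x - w₀ x) 2 μ) atTop
        (𝓝 0) := by
      simpa using ENNReal.Tendsto.const_mul hw (Or.inr ENNReal.ofReal_ne_top)
    refine tendsto_of_tendsto_of_tendsto_of_le_of_le tendsto_const_nhds this
      (fun _ => zero_le) fun n => eLpNorm_le_mul_eLpNorm_of_ae_le_mul ?_ 2
    filter_upwards [hC n] with x hx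
    rw [norm_smul, Real.norm_eq_abs]
    gcongr
  have h2 : Tendsto (fun n => eLpNorm (fun x => (c n x - c₀ x) • w₀ x) 2 μ) atTop (𝓝 0) := by
    have key : Tendsto (fun n => ∫⁻ x, ‖(c n x - c₀ x) • w₀ x‖ₑ ^ (2 : ℝ) ∂μ) atTop
        (𝓝 (∫⁻ _, 0 ∂μ)) := by
      refine tendsto_lintegral_of_dominated_convergence'
        (fun x => (ENNReal.ofReal (2 * C) * ‖w₀ x‖ₑ) ^ (2 : ℝ)) ?_ ?_ ?_ ?_
      · exact fun n => (((hcm n).sub hcm₀).smul hw₀.1).enorm.pow_const _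
      · intro n
        filter_upwards [hC n, hC₀] with x hx hx₀
        gcongr
        rw [enorm_smul]
        gcongr
        rw [Real.enorm_eq_ofReal_abs]
        gcongr
        calc |c n x - c₀ x| ≤ |c n x| + |c₀ x| := abs_sub _ _
          _ ≤ 2 * C := by linarith
      · simp_rw [ENNReal.mul_rpow_of_nonneg _ _ (zero_le_two (α := ℝ))]
        rw [lintegral_const_mul'' _ (hw₀.1.enorm.pow_const _)]
        refine ENNReal.mul_ne_top (by finiteness) ?_
        have := lintegral_rpow_enorm_lt_top_of_eLpNorm_lt_top two_ne_zero
          ENNReal.ofNat_ne_top hw₀.2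
        simpa using this.ne
      · filter_upwards [hlim] with x hx
        have h : Tendsto (fun n => ‖(c n x - c₀ x) • w₀ x‖ₑ ^ (2 : ℝ)) atTop
            (𝓝 (‖(c₀ x - c₀ x) • w₀ x‖ₑ ^ (2 : ℝ))) :=
          ((ENNReal.continuous_rpow_const).tendsto _).comp
            ((hx.sub_const (c₀ x)).smul_const (w₀ x)).enorm
        simpa using h
    have := ((ENNReal.continuous_rpow_const (y := 1 / (2 : ℝ))).tendsto _).comp key
    simp only [eLpNorm_eq_lintegral_rpow_enorm_toReal two_ne_zero ENNReal.ofNat_ne_top]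
    simpa [Function.comp_def] using this
  refine tendsto_of_tendsto_of_tendsto_of_le_of_le tendsto_const_nhds
    (by simpa using h1.add h2) (fun _ => zero_le) fun n => ?_
  refine le_trans (le_of_eq ?_) (eLpNorm_add_le
    ((hcm n).smul ((hwm n).sub hw₀.1)) (((hcm n).sub hcm₀).smul hw₀.1) one_le_two)
  congr 1
  ext x
  simp only [Pi.add_apply, smul_sub, sub_smul]
  abel

theorem tendsto_eLpNorm_add_sub {v w : ℕ → α → E} {v₀ w₀ : α → E}
    (hvm : ∀ n, AEStronglyMeasurable (v n) μ) (hv₀ : AEStronglyMeasurable v₀ μ)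
    (hwm : ∀ n, AEStronglyMeasurable (w n) μ) (hw₀ : AEStronglyMeasurable w₀ μ)
    (hv : Tendsto (fun n => eLpNorm (fun x => v n x - v₀ x) 2 μ) atTop (𝓝 0))
    (hw : Tendsto (fun n => eLpNorm (fun x => w n x - w₀ x) 2 μ) atTop (𝓝 0)) :
    Tendsto (fun n => eLpNorm (fun x => (v n x + w n x) - (v₀ x + w₀ x)) 2 μ) atTop (𝓝 0) := by
  refine tendsto_of_tendsto_of_tendsto_of_le_of_le tendsto_const_nhds
    (by simpa using hv.add hw) (fun _ => zero_le) fun n => ?_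
  refine le_trans (le_of_eq ?_)
    (eLpNorm_add_le ((hvm n).sub hv₀) ((hwm n).sub hw₀) one_le_two)
  congr 1
  ext x
  simp only [Pi.add_apply]
  abel

theorem tendsto_integral_inner [InnerProductSpace ℝ E] {v w : ℕ → α → E} {v₀ w₀ : α → E}
    (hvm : ∀ n, MemLp (v n) 2 μ) (hv₀ : MemLp v₀ 2 μ)
    (hwm : ∀ n, MemLp (w n) 2 μ) (hw₀ : MemLp w₀ 2 μ)
    (hv : Tendsto (fun n => eLpNorm (fun x => v n x - v₀ x) 2 μ) atTop (𝓝 0))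
    (hw : Tendsto (fun n => eLpNorm (fun x => w n x - w₀ x) 2 μ) atTop (𝓝 0)) :
    Tendsto (fun n => ∫ x, inner ℝ (v n x) (w n x) ∂μ) atTop
      (𝓝 (∫ x, inner ℝ (v₀ x) (w₀ x) ∂μ)) := by
  have key : ∀ {f g : α → E} (hf : MemLp f 2 μ) (hg : MemLp g 2 μ),
      inner ℝ (hf.toLp f) (hg.toLp g) = ∫ x, inner ℝ (f x) (g x) ∂μ := by
    intro f g hf hg
    rw [L2.inner_def]
    refine integral_congr_ae ?_
    filter_upwards [hf.coeFn_toLp, hg.coeFn_toLp] with x h1 h2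
    rw [h1, h2]
  have h1 := (Lp.tendsto_Lp_iff_tendsto_eLpNorm'' v hvm v₀ hv₀).2 hv
  have h2 := (Lp.tendsto_Lp_iff_tendsto_eLpNorm'' w hwm w₀ hw₀).2 hw
  simpa only [key] using h1.inner (𝕜 := ℝ) h2

theorem tendsto_integral_mul {v w : ℕ → α → ℝ} {v₀ w₀ : α → ℝ}
    (hvm : ∀ n, MemLp (v n) 2 μ) (hv₀ : MemLp v₀ 2 μ)
    (hwm : ∀ n, MemLp (w n) 2 μ) (hw₀ : MemLp w₀ 2 μ)
    (hv : Tendsto (fun n => eLpNorm (fun x => v n x - v₀ x) 2 μ) atTop (𝓝 0))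
    (hw : Tendsto (fun n => eLpNorm (fun x => w n x - w₀ x) 2 μ) atTop (𝓝 0)) :
    Tendsto (fun n => ∫ x, v n x * w n x ∂μ) atTop (𝓝 (∫ x, v₀ x * w₀ x ∂μ)) := by
  simpa [mul_comm] using tendsto_integral_inner hvm hv₀ hwm hw₀ hv hw

theorem tendsto_eLpNorm_self (v : α → E) :
    Tendsto (fun _ : ℕ => eLpNorm (fun x => v x - v x) 2 μ) atTop (𝓝 0) := by
  simp

theorem memLp_bounded_smul [NormedSpace ℝ E] {c : α → ℝ} {w : α → E} {C : ℝ}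
    (hw : MemLp w 2 μ) (hcm : AEStronglyMeasurable c μ) (hC : ∀ᵐ x ∂μ, |c x| ≤ C) :
    MemLp (fun x => c x • w x) 2 μ := by
  refine hw.of_le_mul (c := C) (hcm.smul hw.1) ?_
  filter_upwards [hC] with x hx
  rw [norm_smul, Real.norm_eq_abs]
  gcongr

end LTwo

/-! ### Chain and product rules in `H¹₀`. -/

section Sobolev

variable {N : ℕ} {Ω : Set (EuclideanSpace ℝ (Fin N))}

theorem continuous_gradient {ψ : EuclideanSpace ℝ (Fin N) → ℝ} (h : ContDiff ℝ ∞ ψ) :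
    Continuous (gradient ψ) :=
  (InnerProductSpace.toDual ℝ _).symm.continuous.comp (h.continuous_fderiv (by simp))

theorem gradient_comp {H : ℝ → ℝ} {ψ : EuclideanSpace ℝ (Fin N) → ℝ}
    {x : EuclideanSpace ℝ (Fin N)} (hH : DifferentiableAt ℝ H (ψ x))
    (hψ : DifferentiableAt ℝ ψ x) :
    gradient (fun y => H (ψ y)) x = deriv H (ψ x) • gradient ψ x := by
  have h : fderiv ℝ (fun y => H (ψ y)) x = deriv H (ψ x) • fderiv ℝ ψ x :=
    (hH.hasDerivAt.comp_hasFDerivAt x hψ.hasFDerivAt).fderiv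
  simp [gradient, h]

theorem gradient_mul {ψ χ : EuclideanSpace ℝ (Fin N) → ℝ}
    {x : EuclideanSpace ℝ (Fin N)} (hψ : DifferentiableAt ℝ ψ x) (hχ : DifferentiableAt ℝ χ x) :
    gradient (fun y => ψ y * χ y) x = χ x • gradient ψ x + ψ x • gradient χ x := by
  have h : fderiv ℝ (fun y => ψ y * χ y) x = ψ x • fderiv ℝ χ x + χ x • fderiv ℝ ψ x :=
    (hψ.hasFDerivAt.mul hχ.hasFDerivAt).fderiv
  simp [gradient, h, add_comm]

namespace IsTestFunction

variable {ψ : EuclideanSpace ℝ (Fin N) → ℝ}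

theorem memLp (h : IsTestFunction Ω ψ) (μ : Measure (EuclideanSpace ℝ (Fin N)))
    [IsFiniteMeasureOnCompacts μ] (p : ℝ≥0∞) : MemLp ψ p μ :=
  h.smooth.continuous.memLp_of_hasCompactSupport h.hasCompactSupport

theorem hasCompactSupport_gradient (h : IsTestFunction Ω ψ) : HasCompactSupport (gradient ψ) :=
  (h.hasCompactSupport.fderiv (𝕜 := ℝ)).comp_left
    (g := (InnerProductSpace.toDual ℝ (EuclideanSpace ℝ (Fin N))).symm) (map_zero _)

theorem memLp_gradient (h : IsTestFunction Ω ψ) (μ : Measure (EuclideanSpace ℝ (Fin N)))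
    [IsFiniteMeasureOnCompacts μ] (p : ℝ≥0∞) : MemLp (gradient ψ) p μ :=
  (continuous_gradient h.smooth).memLp_of_hasCompactSupport h.hasCompactSupport_gradient

theorem exists_abs_le (h : IsTestFunction Ω ψ) : ∃ C, ∀ x, |ψ x| ≤ C :=
  h.hasCompactSupport.exists_bound_of_continuous h.smooth.continuous

theorem mul (h : IsTestFunction Ω ψ) {χ : EuclideanSpace ℝ (Fin N) → ℝ}
    (hχ : ContDiff ℝ ∞ χ) : IsTestFunction Ω (fun x => ψ x * χ x) where
  smooth := h.smooth.mul hχ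
  hasCompactSupport := h.hasCompactSupport.mul_right
  tsupport_subset := (tsupport_mul_subset_left (f := ψ) (g := χ)).trans h.tsupport_subset

theorem comp (h : IsTestFunction Ω ψ) {H : ℝ → ℝ} (hH : ContDiff ℝ ∞ H) (h0 : H 0 = 0) :
    IsTestFunction Ω (fun x => H (ψ x)) where
  smooth := hH.comp h.smooth
  hasCompactSupport := h.hasCompactSupport.comp_left h0
  tsupport_subset := by
    refine (closure_mono fun x hx => ?_).trans h.tsupport_subset
    intro h'
    exact hx (by simp [h', h0])

theorem differentiable (h : IsTestFunction Ω ψ) : Differentiable ℝ ψ :=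
  h.smooth.differentiable (by simp)

end IsTestFunction

namespace MemH10With

variable {v : EuclideanSpace ℝ (Fin N) → ℝ}
  {G : EuclideanSpace ℝ (Fin N) → EuclideanSpace ℝ (Fin N)}

/-- Convergence in `L²` gives convergence almost everywhere along a subsequence; this is what lets
nonlinear functions of the approximants pass to the limit. -/
theorem exists_approx_ae (h : MemH10With Ω v G) :
    ∃ ψ : ℕ → EuclideanSpace ℝ (Fin N) → ℝ, (∀ n, IsTestFunction Ω (ψ n)) ∧
      Tendsto (fun n => eLpNorm (fun x => ψ n x - v x) 2 (volume.restrict Ω)) atTop (𝓝 0) ∧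
      Tendsto (fun n => eLpNorm (fun x => gradient (ψ n) x - G x) 2 (volume.restrict Ω))
        atTop (𝓝 0) ∧
      ∀ᵐ x ∂(volume.restrict Ω), Tendsto (fun n => ψ n x) atTop (𝓝 (v x)) := by
  obtain ⟨ψ, hψ, h1, h2⟩ := h.approx
  obtain ⟨ns, hns, hae⟩ := (tendstoInMeasure_of_tendsto_eLpNorm two_ne_zero
    (fun n => ((hψ n).memLp _ 2).1) h.memLp.1 h1).exists_seq_tendsto_ae
  exact ⟨fun n => ψ (ns n), fun n => hψ _, h1.comp hns.tendsto_atTop,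
    h2.comp hns.tendsto_atTop, hae⟩

/-- Because `H 0 = 0`, composing the approximants with `H` keeps their compact support in `Ω`; the
bound on the derivative controls both the values and the gradients. -/
theorem comp (h : MemH10With Ω v G) {H : ℝ → ℝ} (hH : ContDiff ℝ ∞ H) (h0 : H 0 = 0) {C : ℝ}
    (hC : ∀ t, |deriv H t| ≤ C) :
    MemH10With Ω (fun x => H (v x)) (fun x => deriv H (v x) • G x) := by
  have hd : Differentiable ℝ H := hH.differentiable (by simp)
  have hdc : Continuous (deriv H) := hH.continuous_deriv (by simp)
  have hlip : ∀ s t, |H s - H t| ≤ C * |s - t| := fun s t =>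
    (convex_univ (𝕜 := ℝ)).norm_image_sub_le_of_norm_deriv_le (f := H)
      (fun x _ => hd x) (fun x _ => hC x) (mem_univ t) (mem_univ s)
  obtain ⟨ψ, hψ, h1, h2, hae⟩ := h.exists_approx_ae
  refine ⟨?_, ?_, fun n x => H (ψ n x), fun n => (hψ n).comp hH h0, ?_, ?_⟩
  · refine h.memLp.of_le_mul (c := C)
      (hH.continuous.comp_aestronglyMeasurable h.memLp.1) (Eventually.of_forall fun x => ?_)
    simpa [h0] using hlip (v x) 0
  · exact memLp_bounded_smul h.memLp_grad (hdc.comp_aestronglyMeasurable h.memLp.1)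
      (Eventually.of_forall fun x => hC _)
  · have : Tendsto (fun n => ENNReal.ofReal C *
        eLpNorm (fun x => ψ n x - v x) 2 (volume.restrict Ω)) atTop (𝓝 0) := by
      simpa using ENNReal.Tendsto.const_mul h1 (Or.inr ENNReal.ofReal_ne_top)
    exact tendsto_of_tendsto_of_tendsto_of_le_of_le tendsto_const_nhds this
      (fun _ => zero_le) fun n => eLpNorm_le_mul_eLpNorm_of_ae_le_mul
        (Eventually.of_forall fun x => hlip _ _) 2
  · have := tendsto_eLpNorm_smul_sub (c := fun n x => deriv H (ψ n x))
      (c₀ := fun x => deriv H (v x)) (w := fun n => gradient (ψ n)) (w₀ := G) (C := C)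
      (fun n => (hdc.comp (hψ n).smooth.continuous).aestronglyMeasurable)
      (fun n => Eventually.of_forall fun x => hC _)
      (hae.mono fun x hx => (hdc.tendsto _).comp hx)
      (fun n => ((hψ n).memLp_gradient _ 2).1) h.memLp_grad h2
    refine this.congr fun n => eLpNorm_congr_ae (Eventually.of_forall fun x => ?_)
    simp only [gradient_comp (hd _) ((hψ n).differentiable x)]

/-- Source of the test functions `ψ² / (u + ε)` and `ψ k(u)`. The factor `ψ` supplies compact
support, so `k` need not vanish at `0`, and its boundedness keeps the term containing `∇v` in `L²`.
-/
theorem test_mul_comp (h : MemH10With Ω v G) {ψ : EuclideanSpace ℝ (Fin N) → ℝ}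
    (hψ : IsTestFunction Ω ψ) {k : ℝ → ℝ} (hk : ContDiff ℝ ∞ k) {C C' : ℝ}
    (hC : ∀ t, |k t| ≤ C) (hC' : ∀ t, |deriv k t| ≤ C') :
    MemH10With Ω (fun x => ψ x * k (v x))
      (fun x => k (v x) • gradient ψ x + (ψ x * deriv k (v x)) • G x) := by
  have hd : Differentiable ℝ k := hk.differentiable (by simp)
  have hdc : Continuous (deriv k) := hk.continuous_deriv (by simp)
  obtain ⟨A, hA⟩ := hψ.exists_abs_le
  have hA' : ∀ x t, |ψ x * deriv k t| ≤ A * C' := fun x t => by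
    rw [abs_mul]
    exact mul_le_mul (hA x) (hC' t) (abs_nonneg _) ((abs_nonneg _).trans (hA x))
  have hkv : AEStronglyMeasurable (fun x => k (v x)) (volume.restrict Ω) :=
    hk.continuous.comp_aestronglyMeasurable h.memLp.1
  have hψk : AEStronglyMeasurable (fun x => ψ x * deriv k (v x)) (volume.restrict Ω) :=
    hψ.smooth.continuous.aestronglyMeasurable.mul (hdc.comp_aestronglyMeasurable h.memLp.1)
  have m1 := memLp_bounded_smul (hψ.memLp_gradient (volume.restrict Ω) 2) hkv
    (Eventually.of_forall fun x => hC _)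
  have m2 := memLp_bounded_smul h.memLp_grad hψk (Eventually.of_forall fun x => hA' x _)
  obtain ⟨χ, hχ, h1, h2, hae⟩ := h.exists_approx_ae
  refine ⟨?_, m1.add m2, fun n x => ψ x * k (χ n x),
    fun n => hψ.mul (hk.comp (hχ n).smooth), ?_, ?_⟩
  · simpa only [smul_eq_mul, mul_comm] using memLp_bounded_smul (hψ.memLp (volume.restrict Ω) 2)
      hkv (Eventually.of_forall fun x => hC _)
  · have := tendsto_eLpNorm_smul_sub (c := fun n x => k (χ n x))
      (c₀ := fun x => k (v x)) (w := fun n => ψ) (w₀ := ψ) (C := C)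
      (fun n => (hk.continuous.comp (hχ n).smooth.continuous).aestronglyMeasurable)
      (fun n => Eventually.of_forall fun x => hC _)
      (hae.mono fun x hx => (hk.continuous.tendsto _).comp hx)
      (fun n => (hψ.memLp _ 2).1) (hψ.memLp _ 2) (tendsto_eLpNorm_self ψ)
    simpa only [smul_eq_mul, mul_comm] using this
  · have e1 := tendsto_eLpNorm_smul_sub (c := fun n x => k (χ n x))
      (c₀ := fun x => k (v x)) (w := fun n => gradient ψ) (w₀ := gradient ψ) (C := C)
      (fun n => (hk.continuous.comp (hχ n).smooth.continuous).aestronglyMeasurable)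
      (fun n => Eventually.of_forall fun x => hC _)
      (hae.mono fun x hx => (hk.continuous.tendsto _).comp hx)
      (fun n => (hψ.memLp_gradient _ 2).1) (hψ.memLp_gradient _ 2)
      (tendsto_eLpNorm_self (gradient ψ))
    have hm : ∀ n, AEStronglyMeasurable (fun x => ψ x * deriv k (χ n x))
        (volume.restrict Ω) := fun n =>
      (hψ.smooth.continuous.mul (hdc.comp (hχ n).smooth.continuous)).aestronglyMeasurable
    have e2 := tendsto_eLpNorm_smul_sub (c := fun n x => ψ x * deriv k (χ n x))
      (c₀ := fun x => ψ x * deriv k (v x)) (w := fun n => gradient (χ n)) (w₀ := G)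
      (C := A * C') hm
      (fun n => Eventually.of_forall fun x => hA' x _)
      (hae.mono fun x hx => ((hdc.tendsto _).comp hx).const_mul _)
      (fun n => ((hχ n).memLp_gradient _ 2).1) h.memLp_grad h2
    have := tendsto_eLpNorm_add_sub
      (fun n => (hk.continuous.comp (hχ n).smooth.continuous).aestronglyMeasurable.smul
        (hψ.memLp_gradient _ 2).1) m1.1
      (fun n => (hm n).smul ((hχ n).memLp_gradient _ 2).1) m2.1 e1 e2
    refine this.congr fun n => eLpNorm_congr_ae (Eventually.of_forall fun x => ?_)
    simp only [Pi.smul_apply']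
    rw [gradient_mul (χ := fun y => k (χ n y)) (hψ.differentiable x)
      ((hd _).comp x ((hχ n).differentiable x)), gradient_comp (hd _) ((hχ n).differentiable x),
      smul_smul]
    rfl

/-- A positive function in `H¹₀(Ω)` is a limit of nonnegative test functions. -/
theorem exists_approx_nonneg (hfin : volume Ω ≠ ⊤) (h : MemH10With Ω v G)
    (hpos : ∀ᵐ x ∂(volume.restrict Ω), 0 < v x) :
    ∃ ψ : ℕ → EuclideanSpace ℝ (Fin N) → ℝ, (∀ n, IsTestFunction Ω (ψ n)) ∧
      (∀ n x, 0 ≤ ψ n x) ∧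
      Tendsto (fun n => eLpNorm (fun x => ψ n x - v x) 2 (volume.restrict Ω)) atTop (𝓝 0) ∧
      Tendsto (fun n => eLpNorm (fun x => gradient (ψ n) x - G x) 2 (volume.restrict Ω))
        atTop (𝓝 0) := by
  obtain ⟨ψ, hψ, h1, h2, hae⟩ := h.exists_approx_ae
  set δ : ℕ → ℝ := fun n => 1 / ((n : ℝ) + 1) with hδ
  have hδ0 : ∀ n, 0 < δ n := fun n => Nat.one_div_pos_of_nat
  have hδt : Tendsto δ atTop (𝓝 0) := tendsto_one_div_add_atTop_nhds_zero_nat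
  have hsq : ∀ n t, 0 < t ^ 2 + δ n ^ 2 := fun n t => by have := hδ0 n; positivity
  -- A smooth substitute for `|t|`: it vanishes at `0`, is nonnegative and 1-Lipschitz, and differs
  -- from `t` by at most `δ n` for `t > 0`. The finite measure of `Ω` makes this error small in
  -- `L²`.
  set s : ℕ → ℝ → ℝ := fun n t => √(t ^ 2 + δ n ^ 2) - δ n with hs
  have hsd : ∀ n t, HasDerivAt (s n) (t / √(t ^ 2 + δ n ^ 2)) t := fun n t => by
    have := ((((hasDerivAt_id t).pow 2).add_const (δ n ^ 2)).sqrt (hsq n t).ne').sub_const (δ n)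
    exact this.congr_deriv (by simp [mul_div_mul_left])
  have hsm : ∀ n, ContDiff ℝ ∞ (s n) := fun n =>
    (((contDiff_id.pow 2).add contDiff_const).sqrt fun t => (hsq n t).ne').sub contDiff_const
  have hs0 : ∀ n, s n 0 = 0 := fun n => by simp [hs, Real.sqrt_sq (hδ0 n).le]
  have habs : ∀ n t, |t| ≤ √(t ^ 2 + δ n ^ 2) := fun n t => by
    rw [← Real.sqrt_sq_eq_abs]
    exact Real.sqrt_le_sqrt (by nlinarith [sq_nonneg (δ n)])
  have hder : ∀ n t, |t / √(t ^ 2 + δ n ^ 2)| ≤ 1 := fun n t => by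
    rw [abs_div, abs_of_nonneg (Real.sqrt_nonneg _)]
    exact div_le_one_of_le₀ (habs n t) (Real.sqrt_nonneg _)
  have hsn : ∀ n t, 0 ≤ s n t := fun n t => by
    have : √(δ n ^ 2) ≤ √(t ^ 2 + δ n ^ 2) := Real.sqrt_le_sqrt (by nlinarith [sq_nonneg t])
    rw [Real.sqrt_sq (hδ0 n).le] at this
    simpa [hs] using this
  have hle : ∀ n t, 0 < t → |s n t - t| ≤ δ n := fun n t ht => by
    have h1 := habs n t
    rw [abs_of_pos ht] at h1
    have h2 : √(t ^ 2 + δ n ^ 2) ≤ t + δ n := by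
      rw [Real.sqrt_le_left (by linarith [hδ0 n])]
      nlinarith [hδ0 n]
    rw [abs_le]
    constructor <;> simp only [hs] <;> linarith
  have hlip : ∀ n p q, |s n p - s n q| ≤ |p - q| := fun n p q => by
    have := (convex_univ (𝕜 := ℝ)).norm_image_sub_le_of_norm_hasDerivWithin_le (f := s n)
      (fun x _ => (hsd n x).hasDerivWithinAt) (fun x _ => hder n x) (mem_univ q) (mem_univ p)
    simpa using this
  have : IsFiniteMeasure (volume.restrict Ω) := ⟨by simpa using hfin.lt_top⟩
  refine ⟨fun n x => s n (ψ n x), fun n => (hψ n).comp (hsm n) (hs0 n), fun n x => hsn _ _,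
    ?_, ?_⟩
  · have hb : Tendsto (fun n => eLpNorm (fun x => ψ n x - v x) 2 (volume.restrict Ω) +
        eLpNorm (fun _ => δ n) 2 (volume.restrict Ω)) atTop (𝓝 0) := by
      have : Tendsto (fun n => eLpNorm (fun _ : EuclideanSpace ℝ (Fin N) => δ n) 2
          (volume.restrict Ω)) atTop (𝓝 0) := by
        simp only [eLpNorm_const' _ two_ne_zero ENNReal.ofNat_ne_top]
        have h0 : Tendsto (fun n => ‖δ n‖ₑ) atTop (𝓝 0) := by
          simpa using hδt.enorm
        simpa using ENNReal.Tendsto.mul_const h0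
          (Or.inr (ENNReal.rpow_ne_top_of_nonneg (y := 1 / (2 : ℝ≥0∞).toReal) (by simp)
            (measure_ne_top (volume.restrict Ω) univ)))
      simpa using h1.add this
    refine tendsto_of_tendsto_of_tendsto_of_le_of_le tendsto_const_nhds hb
      (fun _ => zero_le) fun n => ?_
    have hm1 : AEStronglyMeasurable (fun x => |ψ n x - v x|) (volume.restrict Ω) :=
      (((hψ n).memLp _ 2).1.sub h.memLp.1).norm
    calc eLpNorm (fun x => s n (ψ n x) - v x) 2 (volume.restrict Ω)
        ≤ eLpNorm ((fun x => |ψ n x - v x|) + fun _ => δ n) 2 (volume.restrict Ω) := by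
          refine eLpNorm_mono_ae ?_
          filter_upwards [hpos] with x hx
          have e1 := hlip n (ψ n x) (v x)
          have e2 := hle n (v x) hx
          have e3 := abs_sub_le (s n (ψ n x)) (s n (v x)) (v x)
          rw [Real.norm_eq_abs, Real.norm_eq_abs]
          refine le_trans ?_ (le_abs_self _)
          simp only [Pi.add_apply]
          linarith
      _ ≤ _ := eLpNorm_add_le hm1 aestronglyMeasurable_const one_le_two
      _ = _ := by rw [← eLpNorm_norm (fun x => ψ n x - v x)]; rfl
  · have := tendsto_eLpNorm_smul_sub (c := fun n x => ψ n x / √(ψ n x ^ 2 + δ n ^ 2))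
      (c₀ := fun _ => 1) (w := fun n => gradient (ψ n)) (w₀ := G) (C := 1)
      (fun n => ((hψ n).smooth.continuous.div
        (((hψ n).smooth.continuous.pow 2).add continuous_const).sqrt
        fun x => (Real.sqrt_pos.2 (hsq n _)).ne').aestronglyMeasurable)
      (fun n => Eventually.of_forall fun x => hder n _) ?_
      (fun n => ((hψ n).memLp_gradient _ 2).1) h.memLp_grad h2
    · refine this.congr fun n => eLpNorm_congr_ae (Eventually.of_forall fun x => ?_)
      simp only [one_smul]
      rw [gradient_comp (hsd n _).differentiableAt ((hψ n).differentiable _), (hsd n _).deriv]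
    -- Strict positivity is essential here: the derivatives tend to `v / |v| = 1`.
    · filter_upwards [hae, hpos] with x hx hp
      have hl := hx.div ((hx.pow 2).add (hδt.pow 2)).sqrt (by simpa [Real.sqrt_sq hp.le] using hp.ne')
      simpa [Real.sqrt_sq hp.le, hp.ne', Pi.div_def] using hl

end MemH10With

end Sobolev

/-! ### Integrability of products, and smooth cutoffs. -/

theorem integrable_inner_of_memLp {α E : Type*} [MeasurableSpace α] {μ : Measure α}
    [NormedAddCommGroup E] [InnerProductSpace ℝ E] {f g : α → E} (hf : MemLp f 2 μ)
    (hg : MemLp g 2 μ) : Integrable (fun x => inner ℝ (f x) (g x)) μ := by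
  refine (L2.integrable_inner (𝕜 := ℝ) (hf.toLp f) (hg.toLp g)).congr ?_
  filter_upwards [hf.coeFn_toLp, hg.coeFn_toLp] with x h1 h2
  rw [h1, h2]

theorem integrable_mul_of_memLp {α : Type*} [MeasurableSpace α] {μ : Measure α}
    {f g : α → ℝ} (hf : MemLp f 2 μ) (hg : MemLp g 2 μ) :
    Integrable (fun x => f x * g x) μ := by
  simpa [mul_comm] using integrable_inner_of_memLp hf hg

/-- A function smooth near `[0, M]` agrees there with a smooth compactly supported function. -/
theorem exists_contDiff_hasCompactSupport_eventuallyEq {M σ : ℝ} (hM : 0 ≤ M) (hσ : 0 < σ)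
    {k : ℝ → ℝ} (hk : ContDiffOn ℝ ∞ k (Ioo (-σ) (M + σ))) :
    ∃ h : ℝ → ℝ, ContDiff ℝ ∞ h ∧ HasCompactSupport h ∧ ∀ t ∈ Icc 0 M, h =ᶠ[𝓝 t] k := by
  -- The inner ball contains `[0, M]`, and the support `[-σ/2, M + σ/2]` stays where `k` is smooth.
  let χ : ContDiffBump (M / 2) :=
    { rIn := M / 2 + σ / 3, rOut := M / 2 + σ / 2, rIn_pos := by positivity,
      rIn_lt_rOut := by linarith }
  refine ⟨fun t => χ t * k t, ?_, χ.hasCompactSupport.mul_right, fun t ht => ?_⟩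
  · rw [contDiff_iff_contDiffAt]
    intro t
    by_cases ht : t ∈ tsupport χ
    · rw [χ.tsupport_eq, Real.closedBall_eq_Icc] at ht
      have ht' : t ∈ Ioo (-σ) (M + σ) := by
        obtain ⟨h1, h2⟩ := ht
        simp only [χ] at h1 h2
        constructor <;> linarith
      exact χ.contDiff.contDiffAt.mul (hk.contDiffAt (isOpen_Ioo.mem_nhds ht'))
    · refine (contDiffAt_const (c := (0 : ℝ))).congr_of_eventuallyEq ?_
      filter_upwards [notMem_tsupport_iff_eventuallyEq.1 ht] with s hs
      simp [hs]
  · have hb : t ∈ Metric.ball (M / 2) χ.rIn := by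
      rw [Real.ball_eq_Ioo]
      obtain ⟨h1, h2⟩ := ht
      simp only [χ]
      constructor <;> linarith
    filter_upwards [χ.eventuallyEq_one_of_mem_ball hb] with s hs
    simp [hs]

/-! ### Lower bounds for eigenvalues: Poincaré and Picone. -/

section Eigenvalue

variable {N : ℕ} {Ω : Set (EuclideanSpace ℝ (Fin N))}

/-- A constant in the Poincaré inequality for test functions is a lower bound for eigenvalues. -/
theorem le_of_isEigenfunction {κ μ : ℝ} {φ : EuclideanSpace ℝ (Fin N) → ℝ}
    (h : ∀ ψ, IsTestFunction Ω ψ → κ * ∫ x in Ω, ψ x * ψ x ≤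
      ∫ x in Ω, inner ℝ (gradient ψ x) (gradient ψ x))
    (hφ : IsEigenfunction Ω μ φ) : κ ≤ μ := by
  obtain ⟨hne, G, hG, hw⟩ := hφ
  obtain ⟨ψ, hψ, h1, h2⟩ := hG.approx
  have l1 := tendsto_integral_mul (fun n => (hψ n).memLp _ 2) hG.memLp
    (fun n => (hψ n).memLp _ 2) hG.memLp h1 h1
  have l2 := tendsto_integral_inner (fun n => (hψ n).memLp_gradient _ 2) hG.memLp_grad
    (fun n => (hψ n).memLp_gradient _ 2) hG.memLp_grad h2 h2
  have hle := le_of_tendsto_of_tendsto' (l1.const_mul κ) l2 fun n => h _ (hψ n)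
  -- The eigenfunction tested with itself: `∫ |∇φ|² = μ ∫ φ²`, and `∫ φ² > 0` can be cancelled.
  rw [hw φ G hG] at hle
  simp only [mul_assoc, integral_const_mul] at hle
  refine le_of_mul_le_mul_right hle ?_
  refine lt_of_le_of_ne (integral_nonneg fun x => mul_self_nonneg _) fun h0 => hne ?_
  have := (integral_eq_zero_iff_of_nonneg (fun x => mul_self_nonneg (φ x))
    (integrable_mul_of_memLp hG.memLp hG.memLp)).1 h0.symm
  filter_upwards [this] with x hx
  simpa using hx

/-- Poincaré inequality. -/
theorem exists_poincare (hN : 1 ≤ N) (hΩ : Bornology.IsBounded Ω) :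
    ∃ κ : ℝ, 0 < κ ∧ ∀ ψ, IsTestFunction Ω ψ → κ * ∫ x in Ω, ψ x * ψ x ≤
      ∫ x in Ω, inner ℝ (gradient ψ x) (gradient ψ x) := by
  obtain ⟨R, hR, hΩR⟩ := hΩ.subset_closedBall_lt 0 0
  -- Integrating by parts against a coordinate `p`, `∫ ψ² = -∫ 2 p ψ ∂ψ ≤ ½ ∫ ψ² + 2 R² ∫ |∇ψ|²`;
  -- absorbing the first term gives `4 R²`.
  refine ⟨1 / (4 * R ^ 2), by positivity, fun ψ hψ => ?_⟩
  have hz : ∀ x, x ∉ Ω → x ∉ tsupport ψ := fun x hx h => hx (hψ.tsupport_subset h)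
  have hz0 : ∀ x, x ∉ Ω → ψ x = 0 := fun x hx => image_eq_zero_of_notMem_tsupport (hz x hx)
  have hzg : ∀ x, x ∉ Ω → gradient ψ x = 0 := fun x hx => by
    have : fderiv ℝ ψ x = 0 := image_eq_zero_of_notMem_tsupport
      fun h => hz x hx (tsupport_fderiv_subset ℝ h)
    simp [gradient, this]
  -- On the whole space the integration by parts has no boundary term.
  rw [setIntegral_eq_integral_of_forall_compl_eq_zero fun x hx => by simp [hz0 x hx],
    setIntegral_eq_integral_of_forall_compl_eq_zero fun x hx => by simp [hzg x hx]]
  let i : Fin N := ⟨0, hN⟩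
  let p : EuclideanSpace ℝ (Fin N) →L[ℝ] ℝ := EuclideanSpace.proj i
  let e : EuclideanSpace ℝ (Fin N) := EuclideanSpace.single i 1
  have hpe : p e = 1 := by simp [p, e]
  have hψc := hψ.smooth.continuous
  have hgc := continuous_gradient hψ.smooth
  have hfd : ∀ x, fderiv ℝ (fun y => ψ y * ψ y) x e = 2 * ψ x * inner ℝ (gradient ψ x) e := by
    intro x
    have : fderiv ℝ (fun y => ψ y * ψ y) x = ψ x • fderiv ℝ ψ x + ψ x • fderiv ℝ ψ x :=
      ((hψ.differentiable x).hasFDerivAt.mul (hψ.differentiable x).hasFDerivAt).fderiv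
    rw [this]
    simp [gradient]
    ring
  have I : ∀ g : EuclideanSpace ℝ (Fin N) → ℝ, Continuous g →
      Integrable (fun x => g x * ψ x) volume := fun g hg =>
    (hg.mul hψc).integrable_of_hasCompactSupport hψ.hasCompactSupport.mul_left
  have i1 : Integrable (fun x => ψ x * ψ x) volume := I ψ hψc
  have i2 : Integrable (fun x => inner ℝ (gradient ψ x) (gradient ψ x)) volume :=
    integrable_inner_of_memLp (hψ.memLp_gradient volume 2) (hψ.memLp_gradient volume 2)
  have i3 : Integrable (fun x => p x * fderiv ℝ (fun y => ψ y * ψ y) x e) volume := by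
    simp only [hfd]
    refine (I (fun x => p x * 2 * inner ℝ (gradient ψ x) e)
      ((p.continuous.mul continuous_const).mul (hgc.inner continuous_const))).congr
      (Eventually.of_forall fun x => ?_)
    simp only
    ring
  have hparts := integral_mul_fderiv_eq_neg_fderiv_mul_of_integrable (μ := volume)
    (f := p) (g := fun y => ψ y * ψ y) (v := e)
    (by simpa [hpe] using i1) i3
    (by simpa [mul_assoc] using I (fun x => p x * ψ x) (p.continuous.mul hψc))
    (fun x _ => p.differentiableAt)
    (fun x _ => (hψ.differentiable x).mul (hψ.differentiable x))
  simp only [ContinuousLinearMap.fderiv, hpe, one_mul] at hparts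
  have hb : -∫ x, p x * fderiv ℝ (fun y => ψ y * ψ y) x e ≤
      ∫ x, (1 / 2 * (ψ x * ψ x) + 2 * R ^ 2 * inner ℝ (gradient ψ x) (gradient ψ x)) := by
    rw [← integral_neg]
    refine integral_mono i3.neg ((i1.const_mul _).add (i2.const_mul _)) fun x => ?_
    simp only [hfd]
    by_cases hx : x ∈ Ω
    · have hp : p x ^ 2 ≤ R ^ 2 := by
        have h1 : ‖x‖ ≤ R := by simpa using hΩR hx
        have h2 : |p x| ≤ ‖x‖ := PiLp.norm_apply_le x i
        exact sq_le_sq' (by linarith [neg_abs_le (p x)]) (by linarith [le_abs_self (p x)])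
      have hd : (inner ℝ (gradient ψ x) e) ^ 2 ≤ inner ℝ (gradient ψ x) (gradient ψ x) := by
        have h1 := abs_real_inner_le_norm (gradient ψ x) e
        have h2 : ‖e‖ = 1 := by simp [e]
        rw [h2, mul_one] at h1
        rw [real_inner_self_eq_norm_sq, ← sq_abs]
        gcongr
      have hm : p x ^ 2 * (inner ℝ (gradient ψ x) e) ^ 2 ≤
          R ^ 2 * inner ℝ (gradient ψ x) (gradient ψ x) := by gcongr
      nlinarith [sq_nonneg (ψ x + 2 * (p x * inner ℝ (gradient ψ x) e))]
    · simp [hz0 x hx, hzg x hx]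
  rw [hparts, neg_neg, integral_add (i1.const_mul _) (i2.const_mul _), integral_const_mul,
    integral_const_mul] at hb
  rw [one_div, inv_mul_le_iff₀ (by positivity)]
  linarith

/-- Rules out the product `0 * ⊤ = 0`, which would spoil the bounds whose second factor is infinite.
-/
theorem firstEigenvalue_pos (hN : 1 ≤ N) (hΩ : Bornology.IsBounded Ω) :
    0 < firstEigenvalue Ω := by
  obtain ⟨κ, hκ, h⟩ := exists_poincare hN hΩ
  refine (ENNReal.ofReal_pos.2 hκ).trans_le (le_sInf ?_)
  rintro _ ⟨μ, ⟨φ, hφ⟩, rfl⟩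
  exact ENNReal.ofReal_le_ofReal (le_of_isEigenfunction h hφ)

/-- Picone's inequality: a positive supersolution bounds the Dirichlet quotient from below. -/
theorem mul_integral_le_of_supersolution {u g : EuclideanSpace ℝ (Fin N) → ℝ} {M ε κ : ℝ}
    (hM : 0 ≤ M) (hε : 0 < ε) (hu : ∀ᵐ x ∂(volume.restrict Ω), u x ∈ Icc 0 M)
    (hw : IsWeakSolution Ω u g) (hg : MemLp g 2 (volume.restrict Ω))
    (hκ : ∀ᵐ x ∂(volume.restrict Ω), κ * (u x + ε) ≤ g x)
    {ψ : EuclideanSpace ℝ (Fin N) → ℝ} (hψ : IsTestFunction Ω ψ) :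
    κ * ∫ x in Ω, ψ x * ψ x ≤ ∫ x in Ω, inner ℝ (gradient ψ x) (gradient ψ x) := by
  obtain ⟨G, hG, hw⟩ := hw
  have hk : ContDiffOn ℝ ∞ (fun t : ℝ => (t + ε)⁻¹) (Ioo (-ε) (M + ε)) :=
    (contDiffOn_id.add contDiffOn_const).inv fun t ht => by
      have := ht.1
      simp only [id]
      linarith
  obtain ⟨k, hks, hkc, hkeq⟩ := exists_contDiff_hasCompactSupport_eventuallyEq hM hε hk
  obtain ⟨C, hC⟩ := hkc.exists_bound_of_continuous hks.continuous
  obtain ⟨C', hC'⟩ := hkc.deriv.exists_bound_of_continuous (hks.continuous_deriv (by simp))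
  have hT := hG.test_mul_comp (hψ.mul hψ.smooth) hks hC hC'
  have heq := hw _ _ hT
  have i0 := integrable_mul_of_memLp (hψ.memLp (volume.restrict Ω) 2) (hψ.memLp _ 2)
  have i1 := integrable_mul_of_memLp hg hT.memLp
  have i2 := integrable_inner_of_memLp hG.memLp_grad hT.memLp_grad
  have i3 := integrable_inner_of_memLp (hψ.memLp_gradient (volume.restrict Ω) 2)
    (hψ.memLp_gradient _ 2)
  rw [← integral_const_mul]
  refine (integral_mono_ae (i0.const_mul κ) i1 ?_).trans
    (heq.symm.le.trans (integral_mono_ae i2 i3 ?_))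
  · filter_upwards [hu, hκ] with x hx hκx
    have hp : 0 < u x + ε := by linarith [hx.1]
    rw [(hkeq _ hx).eq_of_nhds]
    have h1 : κ ≤ g x * (u x + ε)⁻¹ := by
      rwa [← div_eq_mul_inv, le_div_iff₀ hp]
    calc κ * (ψ x * ψ x) ≤ g x * (u x + ε)⁻¹ * (ψ x * ψ x) := by
          gcongr
          exact mul_self_nonneg _
      _ = _ := by ring
  · filter_upwards [hu] with x hx
    have hp : u x + ε ≠ 0 := by linarith [hx.1]
    have hd : deriv k (u x) = -((u x + ε)⁻¹ * (u x + ε)⁻¹) := by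
      rw [(hkeq _ hx).deriv_eq]
      have := ((hasDerivAt_id (u x)).add_const ε).inv hp
      rw [show (fun t : ℝ => (t + ε)⁻¹) = (fun x => id x + ε)⁻¹ from rfl, this.deriv]
      simp only [id]
      field_simp
    rw [hd, (hkeq _ hx).eq_of_nhds, gradient_mul (hψ.differentiable x) (hψ.differentiable x)]
    set r := (u x + ε)⁻¹
    -- Picone's pointwise inequality is this square expanded: `2 r ψ ∇u·∇ψ - r² ψ² |∇u|² ≤ |∇ψ|²`.
    have hsq := real_inner_self_nonneg (x := gradient ψ x - (r * ψ x) • G x)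
    rw [inner_sub_sub_self] at hsq
    simp only [inner_add_right, inner_smul_right,
      inner_smul_left, conj_trivial] at hsq ⊢
    rw [real_inner_comm (G x) (gradient ψ x)] at *
    nlinarith

end Eigenvalue

/-! ### The nonlinearity and its constants. -/

section Nonlinearity

variable {a : ℝ≥0∞} {F : ℝ → ℝ}

theorem openDom_subset_dom (a : ℝ≥0∞) : openDom a ⊆ dom a := fun _ h => ⟨h.1.le, h.2⟩

theorem isOpen_openDom (a : ℝ≥0∞) : IsOpen (openDom a) :=
  isOpen_Ioi.inter (isOpen_Iio.preimage ENNReal.continuous_ofReal)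

theorem Icc_subset_dom {M : ℝ} (hM : ENNReal.ofReal M < a) : Icc 0 M ⊆ dom a :=
  fun _ h => ⟨h.1, (ENNReal.ofReal_le_ofReal h.2).trans_lt hM⟩

theorem exists_pos_ofReal_add_lt {M : ℝ} (hM0 : 0 ≤ M) (hM : ENNReal.ofReal M < a) :
    ∃ σ : ℝ, 0 < σ ∧ ENNReal.ofReal (M + σ) < a := by
  obtain ⟨r, h1, h2⟩ := ENNReal.lt_iff_exists_nnreal_btwn.1 hM
  refine ⟨r - M, ?_, ?_⟩
  · rw [ENNReal.ofReal, ENNReal.coe_lt_coe, Real.toNNReal_lt_iff_lt_coe hM0] at h1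
    linarith
  · simpa using h2

namespace IsNonlinearity

theorem one_le (hF : IsNonlinearity a F) {t : ℝ} (ht : t ∈ dom a) : 1 ≤ F t := by
  rw [← hF.map_zero]
  exact hF.mono ⟨le_rfl, by simpa using bot_le.trans_lt ht.2⟩ ht ht.1

theorem pos (hF : IsNonlinearity a F) {t : ℝ} (ht : t ∈ dom a) : 0 < F t :=
  one_pos.trans_le (hF.one_le ht)

theorem contDiffAt (hF : IsNonlinearity a F) {t : ℝ} (ht : t ∈ openDom a) :
    ContDiffAt ℝ ∞ F t :=
  hF.smooth.contDiffAt (mem_of_superset ((isOpen_openDom a).mem_nhds ht) (openDom_subset_dom a))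

theorem deriv_nonneg (hF : IsNonlinearity a F) {t : ℝ} (ht : t ∈ openDom a) :
    0 ≤ deriv F t := by
  rw [← derivWithin_of_mem_nhds ((isOpen_openDom a).mem_nhds ht)]
  exact (hF.mono.mono (openDom_subset_dom a)).derivWithin_nonneg

theorem supConst_pos (hF : IsNonlinearity a F) (ha : 0 < a) : 0 < supConst a F := by
  obtain ⟨t, ht0, ht⟩ := exists_pos_ofReal_add_lt le_rfl (by simpa using ha)
  rw [zero_add] at ht
  have hm : t ∈ openDom a := ⟨ht0, ht⟩
  exact (ENNReal.ofReal_pos.2 (div_pos ht0 (hF.pos (openDom_subset_dom a hm)))).trans_le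
    (le_iSup₂ (f := fun τ (_ : τ ∈ openDom a) => ENNReal.ofReal (τ / F τ)) t hm)

theorem le_supConst_mul (hF : IsNonlinearity a F) (hB : supConst a F ≠ ⊤) {t : ℝ}
    (ht : t ∈ dom a) : t ≤ (supConst a F).toReal * F t := by
  rcases ht.1.eq_or_lt with h | h
  · rw [← h, hF.map_zero]
    simp
  · rw [← div_le_iff₀ (hF.pos ht)]
    refine (ENNReal.ofReal_le_iff_le_toReal hB).1 ?_
    exact le_iSup₂ (f := fun τ (_ : τ ∈ openDom a) => ENNReal.ofReal (τ / F τ)) t ⟨h, ht.2⟩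

theorem intConst_pos (hF : IsNonlinearity a F) (ha : 0 < a) : 0 < intConst a F := by
  obtain ⟨t, ht0, ht⟩ := exists_pos_ofReal_add_lt le_rfl (by simpa using ha)
  rw [zero_add] at ht
  have hsub : Ioc 0 t ⊆ openDom a := fun s hs =>
    ⟨hs.1, (ENNReal.ofReal_le_ofReal hs.2).trans_lt ht⟩
  have htm : t ∈ dom a := ⟨ht0.le, ht⟩
  calc (0 : ℝ≥0∞) < ENNReal.ofReal (1 / F t) * volume (Ioc 0 t) := by
        refine ENNReal.mul_pos (ENNReal.ofReal_pos.2 (one_div_pos.2 (hF.pos htm))).ne' ?_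
        simpa using ht0
    _ = ∫⁻ _ in Ioc 0 t, ENNReal.ofReal (1 / F t) := by simp
    _ ≤ ∫⁻ τ in Ioc 0 t, ENNReal.ofReal (1 / F τ) := by
        refine setLIntegral_mono' measurableSet_Ioc fun s hs => ENNReal.ofReal_le_ofReal ?_
        have hsm := openDom_subset_dom a (hsub hs)
        exact one_div_le_one_div_of_le (hF.pos hsm) (hF.mono hsm htm hs.2)
    _ ≤ intConst a F := lintegral_mono_set hsub

/-- The shift `τ ↦ 1 / F (τ + σ)` is smooth up to the boundary of `[0, M]`; it has a compactly
supported smooth extension. -/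
theorem exists_smooth_inv_shift (hF : IsNonlinearity a F) {M σ : ℝ} (hM : 0 ≤ M) (hσ : 0 < σ)
    (hMσ : ENNReal.ofReal (M + 2 * σ) < a) :
    ∃ k : ℝ → ℝ, ContDiff ℝ ∞ k ∧ HasCompactSupport k ∧
      (∀ t ∈ Icc 0 M, k t = (F (t + σ))⁻¹) ∧ ∀ t ∈ Icc 0 M, deriv k t ≤ 0 := by
  -- The shift carries the window `(-σ, M + σ)` to `(0, M + 2σ)`, where `F` is smooth from both
  -- sides; hence the `2 * σ` in the hypothesis.
  have hmem : ∀ t ∈ Ioo (-σ) (M + σ), t + σ ∈ openDom a := fun t ht =>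
    ⟨by linarith [ht.1], (ENNReal.ofReal_le_ofReal (by linarith [ht.2])).trans_lt hMσ⟩
  have hk : ContDiffOn ℝ ∞ (fun t => (F (t + σ))⁻¹) (Ioo (-σ) (M + σ)) := fun t ht => by
    have h1 : ContDiffAt ℝ ∞ (fun t => F (t + σ)) t :=
      (hF.contDiffAt (hmem t ht)).comp t (contDiffAt_id.add contDiffAt_const)
    exact (h1.inv (hF.pos (openDom_subset_dom a (hmem t ht))).ne').contDiffWithinAt
  obtain ⟨k, h1, h2, h3⟩ := exists_contDiff_hasCompactSupport_eventuallyEq hM hσ hk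
  refine ⟨k, h1, h2, fun t ht => (h3 t ht).eq_of_nhds, fun t ht => ?_⟩
  have hm := hmem t ⟨by linarith [ht.1], by linarith [ht.2]⟩
  have hd : HasDerivAt (fun t => F (t + σ)) (deriv F (t + σ)) t :=
    (((hF.contDiffAt hm).differentiableAt (by simp)).hasDerivAt).comp_add_const t σ
  rw [(h3 t ht).deriv_eq, (hd.fun_inv (hF.pos (openDom_subset_dom a hm)).ne').deriv]
  exact div_nonpos_of_nonpos_of_nonneg (neg_nonpos.2 (hF.deriv_nonneg hm)) (sq_nonneg _)

end IsNonlinearity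

theorem integral_le_intConst (hC : intConst a F ≠ ⊤) {k : ℝ → ℝ}
    (hk : Continuous k) {t : ℝ} (ht0 : 0 ≤ t) (ht : ENNReal.ofReal t < a)
    (h0 : ∀ s ∈ Icc 0 t, 0 ≤ k s) (hle : ∀ s ∈ Icc 0 t, k s ≤ 1 / F s) :
    ∫ s in (0 : ℝ)..t, k s ≤ (intConst a F).toReal := by
  refine (ENNReal.ofReal_le_iff_le_toReal hC).1 ?_
  have hsub : Ioc 0 t ⊆ openDom a := fun s hs =>
    ⟨hs.1, (ENNReal.ofReal_le_ofReal hs.2).trans_lt ht⟩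
  rw [intervalIntegral.integral_of_le ht0, ofReal_integral_eq_lintegral_ofReal
    (hk.integrableOn_Ioc) (ae_restrict_of_forall_mem measurableSet_Ioc
      fun s hs => h0 s (Ioc_subset_Icc_self hs))]
  refine (setLIntegral_mono' measurableSet_Ioc fun s hs => ?_).trans (lintegral_mono_set hsub)
  exact ENNReal.ofReal_le_ofReal (hle s (Ioc_subset_Icc_self hs))

end Nonlinearity

/-- Outside `[0, M]` nothing is known about `F`; it is replaced by its continuous extension constant
on each side. -/
theorem aestronglyMeasurable_comp_of_continuousOn_Icc {α : Type*} [MeasurableSpace α]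
    {μ : Measure α} {M : ℝ} (hM : 0 ≤ M) {F : ℝ → ℝ} (hF : ContinuousOn F (Icc 0 M)) {u : α → ℝ}
    (hu : AEStronglyMeasurable u μ) (huM : ∀ᵐ x ∂μ, u x ∈ Icc 0 M) :
    AEStronglyMeasurable (fun x => F (u x)) μ := by
  have hc : Continuous (IccExtend hM ((Icc 0 M).domRestrict F)) :=
    (continuousOn_iff_continuous_domRestrict.1 hF).Icc_extend'
  refine (hc.comp_aestronglyMeasurable hu).congr ?_
  filter_upwards [huM] with x hx
  rw [IccExtend_of_mem _ _ hx, domRestrict_apply]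

/-! ### The two bounds for classical solutions. -/

section Solution

variable {N : ℕ} {Ω : Set (EuclideanSpace ℝ (Fin N))} {f : EuclideanSpace ℝ (Fin N) → ℝ}
  {a : ℝ≥0∞} {F : ℝ → ℝ} {lam : ℝ} {u : EuclideanSpace ℝ (Fin N) → ℝ}

theorem IsBoundedDomain.measure_ne_top (hΩ : IsBoundedDomain Ω) : volume Ω ≠ ⊤ :=
  hΩ.isBounded.measure_lt_top.ne

theorem IsProfile.aestronglyMeasurable (hf : IsProfile Ω f) (hΩ : IsOpen Ω) :
    AEStronglyMeasurable f (volume.restrict Ω) := by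
  obtain ⟨C, r, hr, -, h⟩ := hf.holder
  exact (h.continuousOn hr).aestronglyMeasurable hΩ.measurableSet

theorem IsClassicalSolution.exists_bound (hu : IsClassicalSolution Ω f a F lam u) :
    ∃ M : ℝ, 0 ≤ M ∧ ENNReal.ofReal M < a ∧ ∀ᵐ x ∂(volume.restrict Ω), u x ∈ Icc 0 M := by
  have hne : eLpNorm u ⊤ (volume.restrict Ω) ≠ ⊤ := hu.norm_lt.ne_top
  refine ⟨(eLpNorm u ⊤ (volume.restrict Ω)).toReal, ENNReal.toReal_nonneg, ?_, ?_⟩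
  · rw [ENNReal.ofReal_toReal hne]
    exact hu.norm_lt
  · filter_upwards [hu.mem_dom, ae_le_eLpNormEssSup (f := u) (μ := volume.restrict Ω)]
      with x h1 h2
    refine ⟨h1.1, ?_⟩
    rw [← eLpNorm_exponent_top, Real.enorm_of_nonneg h1.1] at h2
    exact (ENNReal.ofReal_le_iff_le_toReal hne).1 h2

theorem IsClassicalSolution.memLp_reaction (hu : IsClassicalSolution Ω f a F lam u)
    (hΩ : IsBoundedDomain Ω) (hf : IsProfile Ω f) (hF : IsNonlinearity a F) :
    MemLp (fun x => lam * f x * F (u x)) 2 (volume.restrict Ω) := by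
  obtain ⟨M, hM0, hM, huM⟩ := hu.exists_bound
  obtain ⟨G, hG, -⟩ := hu.weak
  obtain ⟨A, hA⟩ := hf.bounded
  have : IsFiniteMeasure (volume.restrict Ω) := ⟨by simpa using hΩ.measure_ne_top.lt_top⟩
  have hsub := Icc_subset_dom hM
  refine MemLp.of_bound ((aestronglyMeasurable_const.mul
    (hf.aestronglyMeasurable hΩ.isOpen)).mul (aestronglyMeasurable_comp_of_continuousOn_Icc hM0
      (hF.smooth.continuousOn.mono hsub) hG.memLp.1 huM)) (|lam| * A * F M) ?_
  filter_upwards [huM, ae_restrict_mem hΩ.isOpen.measurableSet] with x hx hxΩ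
  rw [norm_mul, norm_mul, Real.norm_eq_abs, Real.norm_eq_abs, Real.norm_eq_abs,
    abs_of_nonneg (hf.nonneg x hxΩ), abs_of_pos (hF.pos (hsub hx))]
  have h1 := hA x hxΩ
  have h2 : F (u x) ≤ F M := hF.mono (hsub hx) (hsub ⟨hM0, le_rfl⟩) hx.2
  have h3 := hf.nonneg x hxΩ
  have h4 := (hF.pos (hsub hx)).le
  have h5 : 0 ≤ A := h3.trans h1
  gcongr

/-- Picone's inequality with `κ = lam * m / (B + ε)`, followed by `ε → 0`. -/
theorem IsClassicalSolution.mul_le_eigenvalue_mul (hu : IsClassicalSolution Ω f a F lam u)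
    (hΩ : IsBoundedDomain Ω) (hf : IsProfile Ω f) (hF : IsNonlinearity a F) (hlam : 0 < lam)
    {m B μ : ℝ} (hm : 0 ≤ m) (hmf : ∀ x ∈ Ω, m ≤ f x) (hB0 : 0 ≤ B)
    (hB : ∀ t ∈ dom a, t ≤ B * F t) {φ : EuclideanSpace ℝ (Fin N) → ℝ}
    (hφ : IsEigenfunction Ω μ φ) : lam * m ≤ μ * B := by
  obtain ⟨M, hM0, hM, huM⟩ := hu.exists_bound
  have hsub := Icc_subset_dom hM
  have key : ∀ ε : ℝ, 0 < ε → lam * m ≤ μ * (B + ε) := by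
    intro ε hε
    have hBε : 0 < B + ε := by positivity
    rw [← div_le_iff₀ hBε]
    refine le_of_isEigenfunction (fun ψ hψ => mul_integral_le_of_supersolution hM0 hε huM hu.weak
      (hu.memLp_reaction hΩ hf hF) ?_ hψ) hφ
    filter_upwards [huM, ae_restrict_mem hΩ.isOpen.measurableSet] with x hx hxΩ
    have h1 := hB _ (hsub hx)
    have h2 := hF.one_le (hsub hx)
    have h3 := hmf x hxΩ
    -- The added `ε` is absorbed because `F ≥ 1`.
    have h4 : u x + ε ≤ (B + ε) * F (u x) := by nlinarith
    calc lam * m / (B + ε) * (u x + ε) ≤ lam * m / (B + ε) * ((B + ε) * F (u x)) := by gcongr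
      _ = lam * m * F (u x) := by field_simp
      _ ≤ lam * f x * F (u x) := by gcongr
  have hl : Tendsto (fun ε => μ * (B + ε)) (𝓝[>] 0) (𝓝 (μ * (B + 0))) :=
    (Continuous.tendsto (by fun_prop) 0).mono_left nhdsWithin_le_nhds
  rw [add_zero] at hl
  exact ge_of_tendsto hl (eventually_mem_nhdsWithin.mono fun ε hε => key ε hε)

/-- For nonincreasing `k` with primitive `K`, the function `K ∘ u` is a supersolution:
`-Δ (K ∘ u) ≥ k(u) (-Δ u)`. Here this is tested with a positive eigenfunction. -/
theorem integral_mul_comp_le_of_isWeakSolution {u g φ : EuclideanSpace ℝ (Fin N) → ℝ}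
    {k : ℝ → ℝ} {μ : ℝ} (hfin : volume Ω ≠ ⊤) (hw : IsWeakSolution Ω u g)
    (hg : MemLp g 2 (volume.restrict Ω)) (hk : ContDiff ℝ ∞ k) (hkc : HasCompactSupport k)
    (hk' : ∀ᵐ x ∂(volume.restrict Ω), deriv k (u x) ≤ 0)
    (hφ : IsWeakSolution Ω φ (fun x => μ * φ x))
    (hpos : ∀ᵐ x ∂(volume.restrict Ω), 0 < φ x) :
    ∫ x in Ω, k (u x) * g x * φ x ≤ ∫ x in Ω, μ * φ x * ∫ t in (0 : ℝ)..u x, k t := by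
  obtain ⟨G, hG, hw⟩ := hw
  obtain ⟨P, hP, hφ⟩ := hφ
  obtain ⟨C, hC⟩ := hkc.exists_bound_of_continuous hk.continuous
  obtain ⟨C', hC'⟩ := hkc.deriv.exists_bound_of_continuous (hk.continuous_deriv (by simp))
  have hKd : ∀ t, HasDerivAt (fun t => ∫ s in (0 : ℝ)..t, k s) (k t) t := fun t =>
    (hk.continuous.integral_hasStrictDerivAt 0 t).hasDerivAt
  have hKd' : deriv (fun t => ∫ s in (0 : ℝ)..t, k s) = k := funext fun t => (hKd t).deriv
  have hKs : ContDiff ℝ ∞ (fun t => ∫ s in (0 : ℝ)..t, k s) :=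
    contDiff_infty_iff_deriv.2 ⟨fun t => (hKd t).differentiableAt, by rwa [hKd']⟩
  have hK := hG.comp hKs (by simp) (by rw [hKd']; exact hC)
  rw [← hφ _ _ hK, hKd']
  have hku : AEStronglyMeasurable (fun x => k (u x)) (volume.restrict Ω) :=
    hk.continuous.comp_aestronglyMeasurable hG.memLp.1
  have hkG := memLp_bounded_smul hG.memLp_grad hku (Eventually.of_forall fun x => hC _)
  have hkg : MemLp (fun x => k (u x) * g x) 2 (volume.restrict Ω) :=
    memLp_bounded_smul hg hku (Eventually.of_forall fun x => hC _)
  -- No bound on `φ` is available, so `φ k'(u) ∇u` might not be in `L²`. The equation for `u` is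
  -- tested with `ψ n * k(u)` instead; `ψ n ≥ 0` gives the term `ψ n k'(u) |∇u|²` its sign, and only
  -- the remaining terms pass to the limit.
  obtain ⟨ψ, hψ, hψ0, h1, h2⟩ := hP.exists_approx_nonneg hfin hpos
  have l1 := tendsto_integral_mul (fun _ => hkg) hkg (fun n => (hψ n).memLp _ 2) hP.memLp
    (tendsto_eLpNorm_self _) h1
  have l2 := tendsto_integral_inner (fun n => (hψ n).memLp_gradient _ 2) hP.memLp_grad
    (fun _ => hkG) hkG h2 (tendsto_eLpNorm_self _)
  refine le_of_tendsto_of_tendsto' l1 l2 fun n => ?_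
  have hT := hG.test_mul_comp (hψ n) hk hC hC'
  calc ∫ x in Ω, k (u x) * g x * ψ n x = ∫ x in Ω, g x * (ψ n x * k (u x)) := by
        congr 1
        ext x
        ring
    _ = _ := (hw _ _ hT).symm
    _ ≤ _ := by
        refine integral_mono_ae (integrable_inner_of_memLp hG.memLp_grad hT.memLp_grad)
          (integrable_inner_of_memLp ((hψ n).memLp_gradient _ 2) hkG) ?_
        filter_upwards [hk'] with x hx
        simp only [inner_add_right, inner_smul_right]
        rw [real_inner_comm (G x) (gradient (ψ n) x)]
        have := mul_nonpos_of_nonpos_of_nonneg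
          (mul_nonpos_of_nonneg_of_nonpos (hψ0 n x) hx) (real_inner_self_nonneg (x := G x))
        linarith

/-- For each small shift `s`, the primitive of `1 / F(· + s)` is bounded by `C_F` on `[0, M]`; as `s
→ 0` the factor `F(u) / F(u + s)` increases to at most `1` and converges to `1`, so dominated
convergence applies. -/
theorem IsClassicalSolution.mul_integral_le (hu : IsClassicalSolution Ω f a F lam u)
    (hΩ : IsBoundedDomain Ω) (hf : IsProfile Ω f) (hF : IsNonlinearity a F) (hlam : 0 < lam)
    (hC : intConst a F ≠ ⊤) {μ : ℝ} (hμ : 0 ≤ μ) {φ : EuclideanSpace ℝ (Fin N) → ℝ}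
    (hφ : IsWeakSolution Ω φ (fun x => μ * φ x))
    (hpos : ∀ᵐ x ∂(volume.restrict Ω), 0 < φ x) (hone : ∫ x in Ω, φ x = 1) :
    lam * ∫ x in Ω, f x * φ x ≤ μ * (intConst a F).toReal := by
  obtain ⟨M, hM0, hM, huM⟩ := hu.exists_bound
  have hsub := Icc_subset_dom hM
  obtain ⟨σ, hσ, hMσ⟩ := exists_pos_ofReal_add_lt hM0 hM
  have hg := hu.memLp_reaction hΩ hf hF
  have : IsFiniteMeasure (volume.restrict Ω) := ⟨by simpa using hΩ.measure_ne_top.lt_top⟩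
  have hφL : MemLp φ 2 (volume.restrict Ω) := by
    obtain ⟨P, hP, -⟩ := hφ
    exact hP.memLp
  have hφi : Integrable φ (volume.restrict Ω) := hφL.integrable one_le_two
  have huL : AEStronglyMeasurable u (volume.restrict Ω) := by
    obtain ⟨G, hG, -⟩ := hu.weak
    exact hG.memLp.1
  have hsubσ := Icc_subset_dom hMσ
  have hshift : ∀ {s t : ℝ}, t ∈ Icc 0 M → 0 ≤ s → s ≤ σ → t + s ∈ Icc 0 (M + σ) :=
    fun ht h0 h1 => ⟨by linarith [ht.1], by linarith [ht.2]⟩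
  have hFF : ∀ {s t : ℝ}, t ∈ Icc 0 M → 0 ≤ s → s ≤ σ → F t ≤ F (t + s) :=
    fun ht h0 h1 => hF.mono (hsub ht) (hsubσ (hshift ht h0 h1)) (by linarith)
  have key : ∀ s, 0 < s → 2 * s ≤ σ →
      ∫ x in Ω, (F (u x + s))⁻¹ * (lam * f x * F (u x)) * φ x ≤
        μ * (intConst a F).toReal := by
    intro s hs hsσ
    have hs' : s ≤ σ := by linarith
    obtain ⟨k, hk, hkc, hkeq, hkd⟩ := hF.exists_smooth_inv_shift hM0 hs
      ((ENNReal.ofReal_le_ofReal (by linarith)).trans_lt hMσ)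
    have hle := integral_mul_comp_le_of_isWeakSolution hΩ.measure_ne_top hu.weak hg hk hkc
      (huM.mono fun x hx => hkd _ hx) hφ hpos
    have hbd : ∀ t ∈ Icc 0 M, 0 ≤ k t ∧ k t ≤ 1 / F t := by
      intro t ht
      rw [hkeq t ht, one_div]
      exact ⟨inv_nonneg.2 (hF.pos (hsubσ (hshift ht hs.le hs'))).le,
        inv_anti₀ (hF.pos (hsub ht)) (hFF ht hs.le hs')⟩
    have hKle : ∀ t ∈ Icc 0 M, ∫ τ in (0 : ℝ)..t, k τ ≤ (intConst a F).toReal := fun t ht =>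
      integral_le_intConst hC hk.continuous ht.1 (hsub ht).2
        (fun τ hτ => (hbd τ ⟨hτ.1, hτ.2.trans ht.2⟩).1)
        (fun τ hτ => (hbd τ ⟨hτ.1, hτ.2.trans ht.2⟩).2)
    have hK0 : ∀ t ∈ Icc 0 M, 0 ≤ ∫ τ in (0 : ℝ)..t, k τ := fun t ht =>
      intervalIntegral.integral_nonneg ht.1 fun τ hτ => (hbd τ ⟨hτ.1, hτ.2.trans ht.2⟩).1
    calc ∫ x in Ω, (F (u x + s))⁻¹ * (lam * f x * F (u x)) * φ x
        = ∫ x in Ω, k (u x) * (lam * f x * F (u x)) * φ x :=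
          integral_congr_ae (huM.mono fun x hx => by simp only [hkeq _ hx])
      _ ≤ ∫ x in Ω, μ * φ x * ∫ t in (0 : ℝ)..u x, k t := hle
      _ ≤ ∫ x in Ω, μ * φ x * (intConst a F).toReal := by
          refine integral_mono_of_nonneg ?_ ((hφi.const_mul μ).mul_const _) ?_
          · filter_upwards [huM, hpos] with x hx hp
            exact mul_nonneg (mul_nonneg hμ hp.le) (hK0 _ hx)
          · filter_upwards [huM, hpos] with x hx hp
            exact mul_le_mul_of_nonneg_left (hKle _ hx) (mul_nonneg hμ hp.le)
      _ = μ * (intConst a F).toReal := by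
          rw [integral_mul_const, integral_const_mul, hone, mul_one]
  set s : ℕ → ℝ := fun n => σ / 2 * (1 / ((n : ℝ) + 1))
  have hs0 : ∀ n, 0 < s n := fun n => by positivity
  have hsσ : ∀ n, 2 * s n ≤ σ := fun n => by
    have : 1 / ((n : ℝ) + 1) ≤ 1 := by
      rw [div_le_one (by positivity)]
      linarith [n.cast_nonneg (α := ℝ)]
    simp only [s]
    nlinarith
  have hst : Tendsto s atTop (𝓝 0) := by
    simpa only [mul_zero] using
      (tendsto_one_div_add_atTop_nhds_zero_nat (𝕜 := ℝ)).const_mul (σ / 2)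
  have hlim : Tendsto (fun n => ∫ x in Ω, (F (u x + s n))⁻¹ * (lam * f x * F (u x)) * φ x) atTop
      (𝓝 (∫ x in Ω, lam * f x * φ x)) := by
    obtain ⟨A, hA⟩ := hf.bounded
    refine tendsto_integral_of_dominated_convergence (fun x => lam * A * φ x) ?_
      (hφi.const_mul _) ?_ ?_
    · intro n
      have hss : s n ≤ σ := by linarith [hs0 n, hsσ n]
      refine (AEStronglyMeasurable.mul ?_ hg.1).mul hφi.1
      refine (aestronglyMeasurable_comp_of_continuousOn_Icc (F := fun t => F (t + s n)) hM0
        (hF.smooth.continuousOn.comp (by fun_prop)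
          fun t ht => hsubσ (hshift ht (hs0 n).le hss)) huL
          huM).aemeasurable.inv.aestronglyMeasurable
    · intro n
      have hss : s n ≤ σ := by linarith [hs0 n, hsσ n]
      filter_upwards [huM, hpos, ae_restrict_mem hΩ.isOpen.measurableSet] with x hx hp hxΩ
      have h1 := hF.pos (hsub hx)
      have h2 := hFF hx (hs0 n).le hss
      have h3 : (F (u x + s n))⁻¹ * F (u x) ≤ 1 := by
        rw [inv_mul_le_iff₀ (h1.trans_le h2)]
        linarith
      have h4 : 0 ≤ (F (u x + s n))⁻¹ * F (u x) :=
        mul_nonneg (inv_nonneg.2 (h1.trans_le h2).le) h1.le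
      have h5 := hf.nonneg x hxΩ
      have h6 : 0 ≤ lam * f x * φ x := by positivity
      rw [show (F (u x + s n))⁻¹ * (lam * f x * F (u x)) * φ x =
        (F (u x + s n))⁻¹ * F (u x) * (lam * f x * φ x) by ring, Real.norm_eq_abs,
        abs_of_nonneg (mul_nonneg h4 h6)]
      refine (mul_le_of_le_one_left h6 h3).trans ?_
      have := hA x hxΩ
      gcongr
    · filter_upwards [huM] with x hx
      have hcont : Tendsto (fun n => F (u x + s n)) atTop (𝓝 (F (u x))) := by
        refine (hF.smooth.continuousOn (u x) (hsub hx)).tendsto.comp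
          (tendsto_nhdsWithin_iff.2 ⟨?_, Eventually.of_forall fun n =>
            hsubσ (hshift hx (hs0 n).le (by linarith [hs0 n, hsσ n]))⟩)
        simpa using hst.const_add (u x)
      have hne := (hF.pos (hsub hx)).ne'
      have := ((hcont.inv₀ hne).mul_const (lam * f x * F (u x))).mul_const (φ x)
      rwa [show (F (u x))⁻¹ * (lam * f x * F (u x)) * φ x = lam * f x * φ x by
        field_simp] at this
  have := le_of_tendsto' hlim fun n => key _ (hs0 n) (hsσ n)
  simpa only [mul_assoc, integral_const_mul] using this

theorem extremalParameter_le_of_iInf (hN : 1 ≤ N) (hΩ : IsBoundedDomain Ω) (hf : IsProfile Ω f)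
    (hF : IsNonlinearity a F) (ha : 0 < a) :
    extremalParameter Ω f a F ≤
      firstEigenvalue Ω * (supConst a F / ⨅ x ∈ Ω, ENNReal.ofReal (f x)) := by
  refine sSup_le ?_
  rintro _ ⟨lam, ⟨hlam, u, hu⟩, rfl⟩
  have hpos := firstEigenvalue_pos hN hΩ.isBounded
  have hBpos := hF.supConst_pos ha
  set m := ⨅ x ∈ Ω, ENNReal.ofReal (f x) with hmdef
  have hmle : ∀ x ∈ Ω, m ≤ ENNReal.ofReal (f x) := fun x hx => iInf₂_le x hx
  obtain ⟨x₀, hx₀⟩ := hΩ.isConnected.nonempty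
  have hm : m ≠ ⊤ := ((hmle x₀ hx₀).trans_lt ENNReal.ofReal_lt_top).ne
  by_cases hm0 : m = 0
  · rw [hm0, ENNReal.div_zero hBpos.ne', ENNReal.mul_top hpos.ne']
    exact le_top
  by_cases hB : supConst a F = ⊤
  · rw [hB, ENNReal.top_div_of_ne_top hm, ENNReal.mul_top hpos.ne']
    exact le_top
  -- Isolating `firstEigenvalue Ω` on the right reduces the claim to a lower bound for each
  -- eigenvalue.
  rw [← mul_div_assoc, ENNReal.le_div_iff_mul_le (Or.inl hm0) (Or.inl hm),
    ← ENNReal.div_le_iff_le_mul (Or.inl hBpos.ne') (Or.inl hB)]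
  refine le_sInf ?_
  rintro _ ⟨μ, ⟨φ, hφ⟩, rfl⟩
  rw [ENNReal.div_le_iff_le_mul (Or.inl hBpos.ne') (Or.inl hB), ← ENNReal.ofReal_toReal hm,
    ← ENNReal.ofReal_toReal hB, ← ENNReal.ofReal_mul hlam.le,
    ← ENNReal.ofReal_mul' ENNReal.toReal_nonneg]
  exact ENNReal.ofReal_le_ofReal (hu.mul_le_eigenvalue_mul hΩ hf hF hlam ENNReal.toReal_nonneg
    (fun x hx => ENNReal.toReal_le_of_le_ofReal (hf.nonneg x hx) (hmle x hx))
    ENNReal.toReal_nonneg (fun t ht => hF.le_supConst_mul hB ht) hφ)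

theorem extremalParameter_le_of_integral (hN : 1 ≤ N) (hΩ : IsBoundedDomain Ω)
    (hf : IsProfile Ω f) (hF : IsNonlinearity a F) (ha : 0 < a)
    {φ : EuclideanSpace ℝ (Fin N) → ℝ} (hφ : IsFirstEigenfunction Ω φ) :
    extremalParameter Ω f a F ≤
      firstEigenvalue Ω * (intConst a F / ENNReal.ofReal (∫ x in Ω, f x * φ x)) := by
  refine sSup_le ?_
  rintro _ ⟨lam, ⟨hlam, u, hu⟩, rfl⟩
  have hpos := firstEigenvalue_pos hN hΩ.isBounded
  have hCpos := hF.intConst_pos ha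
  -- Finiteness makes `toReal` faithful; the eigenfunction `φ` itself puts a finite value in the set
  -- whose infimum is taken.
  have hfin : firstEigenvalue Ω ≠ ⊤ :=
    ((sInf_le ⟨_, ⟨φ, hφ.eigen⟩, rfl⟩ : firstEigenvalue Ω ≤ _).trans_lt
      ENNReal.ofReal_lt_top).ne
  by_cases hC : intConst a F = ⊤
  · rw [hC, ENNReal.top_div_of_ne_top ENNReal.ofReal_ne_top, ENNReal.mul_top hpos.ne']
    exact le_top
  have key := hu.mul_integral_le hΩ hf hF hlam hC ENNReal.toReal_nonneg hφ.eigen.2 hφ.pos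
    hφ.normalized
  -- Division is allowed even if `∫ f φ` were `0`, because the numerator is nonzero.
  rw [← mul_div_assoc, ENNReal.le_div_iff_mul_le
    (Or.inr (ENNReal.mul_pos hpos.ne' hCpos.ne').ne') (Or.inl ENNReal.ofReal_ne_top),
    ← ENNReal.ofReal_mul hlam.le]
  refine (ENNReal.ofReal_le_ofReal key).trans_eq ?_
  rw [ENNReal.ofReal_mul ENNReal.toReal_nonneg, ENNReal.ofReal_toReal hfin,
    ENNReal.ofReal_toReal hC]

end Solution

end PullIn

/-- All quantities are in `[0, ∞]`, where `b / 0 = ∞` for `b > 0`. The first bound does not involve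
the eigenfunction, and is also stated on its own. -/
theorem proposition2p3 {N : ℕ} (hN : 1 ≤ N) (Ω : Set (EuclideanSpace ℝ (Fin N)))
    (hΩ : PullIn.IsBoundedDomain Ω) (f : EuclideanSpace ℝ (Fin N) → ℝ)
    (hf : PullIn.IsProfile Ω f) (a : ℝ≥0∞) (F : ℝ → ℝ)
    (hF : (a = ⊤ ∧ PullIn.IsRegularNonlinearity F) ∨ (a = 1 ∧ PullIn.IsSingularNonlinearity F)) :
    PullIn.extremalParameter Ω f a F ≤
        PullIn.firstEigenvalue Ω * (PullIn.supConst a F / ⨅ x ∈ Ω, ENNReal.ofReal (f x)) ∧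
    ∀ φ : EuclideanSpace ℝ (Fin N) → ℝ, PullIn.IsFirstEigenfunction Ω φ →
      PullIn.extremalParameter Ω f a F ≤
        PullIn.firstEigenvalue Ω *
          min (PullIn.supConst a F / ⨅ x ∈ Ω, ENNReal.ofReal (f x))
            (PullIn.intConst a F / ENNReal.ofReal (∫ x in Ω, f x * φ x)) := by
  obtain ⟨hF, ha⟩ : PullIn.IsNonlinearity a F ∧ 0 < a := by
    rcases hF with ⟨rfl, hF⟩ | ⟨rfl, hF⟩
    · exact ⟨hF.1, ENNReal.zero_lt_top⟩
    · exact ⟨hF.1, one_pos⟩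
  have h₁ := PullIn.extremalParameter_le_of_iInf hN hΩ hf hF ha
  refine ⟨h₁, fun φ hφ => ?_⟩
  rcases min_choice (PullIn.supConst a F / ⨅ x ∈ Ω, ENNReal.ofReal (f x))
    (PullIn.intConst a F / ENNReal.ofReal (∫ x in Ω, f x * φ x)) with h | h <;> rw [h]
  · exact h₁
  · exact PullIn.extremalParameter_le_of_integral hN hΩ hf hF ha hφ
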